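/- Let $E$ be a real oriented Euclidean vector space of even dimension, with orthonormal basis $e_1,\dots,e_{\dim E}$. For $e\in E$ let $e^*\in E^*$ be the covector corresponding to $e$ by the scalar product, and let $c(e)=e^*\wedge-i_e$ and $\tilde c(e)\tau^*=e^*\wedge+i_e$ act on the exterior algebra $\Lambda(E^*)$ (with real or with complex coefficients), where $i_e$ is interior multiplication. Let $\nabla$ be the flat connection, and let $$D^{\Lambda(E^*)}=\sum_{i=1}^{\dim E}c(e_i)\nabla_{e_i}$$ act on the space $\Gamma(\Lambda(E^*))$ of smooth sections of $\Lambda(E^*)$ over $E$. Let $Z$ be the generic point of $E$, so that $\tilde c(Z)\tau^*$ acts on $\Gamma(\Lambda(E^*))$ by $(\tilde c(Z)\tau^* u)(Z)=Z^*\wedge u(Z)+i_Zu(Z)$. **Theorem A.3.** For every $T>0$, the space of square-integrable $u\in\Gamma(\Lambda(E^*))$ with $(D^{\Lambda(E^*)}+T\tilde c(Z)\tau^*)u=0$ is one-dimensional and is spanned by $$\beta=\exp\left(-\frac{T|Z|^2}{2}\right)\cdot 1,\qquad 1\in\Lambda^0(E^*).$$ Furthermore, there exists $C>0$, independent of $T$,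 such that for every $T>0$ the operator $D^{\Lambda(E^*)}+T\tilde c(Z)\tau^*$ has no nonzero eigenvalue in $[-C\sqrt T,C\sqrt T]$: if $\mu\in[-C\sqrt T,C\sqrt T]$, $\mu\neq0$, and $u\in\Gamma(\Lambda(E^*))$ is square-integrable with $(D^{\Lambda(E^*)}+T\tilde c(Z)\tau^*)u=\mu u$, then $u=0$. -/

import Mathlib

open MeasureTheory Module
open scoped ContDiff

namespace WittenDirac

noncomputable section

/-- The exterior algebra `Λ(E*)` with coefficients in `𝕜` (`𝕜 = ℝ`, or `𝕜 = ℂ` for complex-valued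
forms): the exterior algebra over `𝕜` of the space `E* ⊗ 𝕜` of `ℝ`-linear maps `E → 𝕜`. -/
abbrev Forms (𝕜 E : Type*) [RCLike 𝕜] [NormedAddCommGroup E] [InnerProductSpace ℝ E] : Type _ :=
  ExteriorAlgebra 𝕜 (E →ₗ[ℝ] 𝕜)

variable (𝕜 : Type*) {E : Type*} [RCLike 𝕜] [NormedAddCommGroup E] [InnerProductSpace ℝ E]

/-- The covector `e*` corresponding to `e` by the scalar product: `e*(v) = ⟪e, v⟫`. -/
def flat : E →ₗ[ℝ] (E →ₗ[ℝ] 𝕜) where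
  toFun e := RCLike.ofRealAm.toLinearMap ∘ₗ innerₗ E e
  map_add' a b := by ext v; simp
  map_smul' r a := by ext v; simp [RCLike.real_smul_eq_coe_mul]

/-- Evaluation of (complexified) covectors at `e`, as a linear form on `E* ⊗ 𝕜`. -/
def evalAt : E →ₗ[ℝ] Dual 𝕜 (E →ₗ[ℝ] 𝕜) where
  toFun e :=
    { toFun := fun f => f e
      map_add' := fun _ _ => rfl
      map_smul' := fun _ _ => rfl }
  map_add' a b := by ext f; simp
  map_smul' r a := by ext f; simp

/-- Exterior multiplication `e* ∧` on `Λ(E*)`. -/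
def wedge : E →ₗ[ℝ] (Forms 𝕜 E →ₗ[𝕜] Forms 𝕜 E) where
  toFun e := LinearMap.mulLeft 𝕜 (ExteriorAlgebra.ι 𝕜 (flat 𝕜 e))
  map_add' a b := by
    refine LinearMap.ext fun w => ?_
    simp [add_mul]
  map_smul' r a := by
    refine LinearMap.ext fun w => ?_
    simp

/-- Interior multiplication `i_e` on `Λ(E*)`: the antiderivation with `i_e(f) = f(e)` on
covectors. -/
def interior : E →ₗ[ℝ] (Forms 𝕜 E →ₗ[𝕜] Forms 𝕜 E) where
  toFun e := CliffordAlgebra.contractLeft (evalAt 𝕜 e)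
  map_add' a b := by rw [map_add, map_add]
  map_smul' r a := by
    rw [map_smul, ← algebraMap_smul 𝕜 r (evalAt 𝕜 a), map_smul, algebraMap_smul]
    rfl

/-- The Clifford action `c(e) = e* ∧ - i_e` on `Λ(E*)`. -/
def cliff : E →ₗ[ℝ] (Forms 𝕜 E →ₗ[𝕜] Forms 𝕜 E) := wedge 𝕜 - interior 𝕜

/-- The operator `c̃(e) τ* = e* ∧ + i_e` on `Λ(E*)`. -/
def cliffHat : E →ₗ[ℝ] (Forms 𝕜 E →ₗ[𝕜] Forms 𝕜 E) := wedge 𝕜 + interior 𝕜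

variable [FiniteDimensional ℝ E]

variable (E) in
/-- The basis `e_i*` of `E* ⊗ 𝕜` dual to an orthonormal basis `e_i` of `E`. -/
def dualBasis : Basis (Fin (finrank ℝ E)) 𝕜 (E →ₗ[ℝ] 𝕜) :=
  Basis.ofEquivFun ((stdOrthonormalBasis ℝ E).toBasis.constr 𝕜).symm

variable (E) in
/-- Coordinates on `Λ(E*)` in the basis of the products `e_{i_1}* ∧ ⋯ ∧ e_{i_k}*`,
`i_1 < ⋯ < i_k`. -/
def coords : Forms 𝕜 E ≃ₗ[𝕜] EuclideanSpace 𝕜 (Finset (Fin (finrank ℝ E))) :=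
  (dualBasis 𝕜 E).ExteriorAlgebra.equivFun ≪≫ₗ (WithLp.linearEquiv 2 𝕜 _).symm

/-- The norm on `Λ(E*)` for which the products `e_{i_1}* ∧ ⋯ ∧ e_{i_k}*`, `i_1 < ⋯ < i_k`, are
orthonormal. -/
instance : NormedAddCommGroup (Forms 𝕜 E) :=
  NormedAddCommGroup.induced (Forms 𝕜 E) (EuclideanSpace 𝕜 (Finset (Fin (finrank ℝ E))))
    (coords 𝕜 E) (coords 𝕜 E).injective

instance : NormedSpace 𝕜 (Forms 𝕜 E) :=
  NormedSpace.induced 𝕜 (Forms 𝕜 E) (EuclideanSpace 𝕜 (Finset (Fin (finrank ℝ E))))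
    (coords 𝕜 E).toLinearMap

instance : NormedSpace ℝ (Forms 𝕜 E) :=
  NormedSpace.induced ℝ (Forms 𝕜 E) (EuclideanSpace 𝕜 (Finset (Fin (finrank ℝ E))))
    ((coords 𝕜 E).toLinearMap.restrictScalars ℝ)

instance : FiniteDimensional 𝕜 (Forms 𝕜 E) :=
  (dualBasis 𝕜 E).ExteriorAlgebra.finiteDimensional_of_finite

instance : FiniteDimensional ℝ (Forms 𝕜 E) :=
  FiniteDimensional.trans ℝ 𝕜 (Forms 𝕜 E)

variable (E) in
/-- The space `Γ(Λ(E*))` of smooth sections of `Λ(E*)` over `E`. -/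
def Sections : Submodule 𝕜 (E → Forms 𝕜 E) where
  carrier := {u | ContDiff ℝ ∞ u}
  add_mem' {u v} hu hv := by
    have hu' : ContDiff ℝ ∞ u := hu
    have hv' : ContDiff ℝ ∞ v := hv
    exact hu'.add hv'
  zero_mem' := (contDiff_const : ContDiff ℝ ∞ fun _ : E => (0 : Forms 𝕜 E))
  smul_mem' a u hu := by
    have hu' : ContDiff ℝ ∞ u := hu
    exact hu'.const_smul a

variable {𝕜} in
theorem contDiff_section (u : Sections 𝕜 E) : ContDiff ℝ ∞ (u : E → Forms 𝕜 E) := u.2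

variable {𝕜} in
theorem differentiableAt_section (u : Sections 𝕜 E) (x : E) :
    DifferentiableAt ℝ (u : E → Forms 𝕜 E) x :=
  ((contDiff_section u).differentiable (by simp)).differentiableAt

/-- The flat covariant derivative `∇_e` on `Γ(Λ(E*))`. -/
def covDeriv (e : E) : Sections 𝕜 E →ₗ[𝕜] Sections 𝕜 E where
  toFun u := ⟨fun x => fderiv ℝ (u : E → Forms 𝕜 E) x e,
    ((contDiff_section u).fderiv_right (m := ∞) (by simp)).clm_apply contDiff_const⟩
  map_add' u v := by
    refine Subtype.ext (funext fun x => ?_)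
    exact congrArg (fun L => L e) (fderiv_add (differentiableAt_section u x) (differentiableAt_section v x))
  map_smul' a u := by
    refine Subtype.ext (funext fun x => ?_)
    exact congrArg (fun L => L e) (fderiv_const_smul (differentiableAt_section u x) a)

/-- The action on sections of a fixed endomorphism of `Λ(E*)`. -/
def applyEnd (A : Forms 𝕜 E →ₗ[𝕜] Forms 𝕜 E) : Sections 𝕜 E →ₗ[𝕜] Sections 𝕜 E where
  toFun u := ⟨fun x => A ((u : E → Forms 𝕜 E) x),
    (A.restrictScalars ℝ).toContinuousLinearMap.contDiff.comp (contDiff_section u)⟩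
  map_add' u v := by refine Subtype.ext (funext fun x => ?_); simp
  map_smul' a u := by refine Subtype.ext (funext fun x => ?_); simp

/-- The Dirac operator `∑ i, c(e_i) ∇_{e_i}` on `Γ(Λ(E*))`, for an orthonormal basis `e_i`. -/
def dirac (e : OrthonormalBasis (Fin (finrank ℝ E)) ℝ E) : Sections 𝕜 E →ₗ[𝕜] Sections 𝕜 E :=
  ∑ i, applyEnd 𝕜 (cliff 𝕜 (e i)) ∘ₗ covDeriv 𝕜 (e i)

theorem contDiff_cliffHat {u : E → Forms 𝕜 E} (hu : ContDiff ℝ ∞ u) :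
    ContDiff ℝ ∞ fun Z => cliffHat 𝕜 Z (u Z) := by
  have h : (fun Z => cliffHat 𝕜 Z (u Z)) = fun Z => ∑ i,
      inner ℝ (stdOrthonormalBasis ℝ E i) Z • cliffHat 𝕜 (stdOrthonormalBasis ℝ E i) (u Z) := by
    funext Z
    have hZ : cliffHat 𝕜 Z = ∑ i,
        inner ℝ (stdOrthonormalBasis ℝ E i) Z • cliffHat 𝕜 (stdOrthonormalBasis ℝ E i) := by
      conv_lhs => rw [← (stdOrthonormalBasis ℝ E).sum_repr' Z]
      simp
    rw [hZ]
    simp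
  rw [h]
  refine ContDiff.sum fun i _ => (contDiff_const.inner ℝ contDiff_id).smul ?_
  exact ((cliffHat 𝕜 (stdOrthonormalBasis ℝ E i)).restrictScalars
    ℝ).toContinuousLinearMap.contDiff.comp hu

variable (E) in
/-- The operator `c̃(Z) τ*` on `Γ(Λ(E*))`, `Z` being the generic point of `E`. -/
def potential : Sections 𝕜 E →ₗ[𝕜] Sections 𝕜 E where
  toFun u := ⟨fun Z => cliffHat 𝕜 Z ((u : E → Forms 𝕜 E) Z), contDiff_cliffHat 𝕜 (contDiff_section u)⟩
  map_add' u v := by refine Subtype.ext (funext fun x => ?_); simp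
  map_smul' a u := by refine Subtype.ext (funext fun x => ?_); simp

/-- The deformed operator `D + T c̃(Z) τ*` on `Γ(Λ(E*))`. -/
def deformedDirac (e : OrthonormalBasis (Fin (finrank ℝ E)) ℝ E) (T : ℝ) :
    End 𝕜 (Sections 𝕜 E) :=
  dirac 𝕜 e + (T : 𝕜) • potential 𝕜 E

variable (E) in
/-- The section `Z ↦ exp (-T |Z|² / 2)` (a form of degree `0`). -/
def gaussian (T : ℝ) : Sections 𝕜 E :=
  ⟨fun Z => Real.exp (-(T * ‖Z‖ ^ 2) / 2) • (1 : Forms 𝕜 E),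
    ContDiff.smul (f := fun Z : E => Real.exp (-(T * ‖Z‖ ^ 2) / 2))
      ((contDiff_const.mul (contDiff_norm_sq ℝ)).neg.div_const 2).exp
      (contDiff_const : ContDiff ℝ ∞ fun _ : E => (1 : Forms 𝕜 E))⟩

variable (E) in
/-- The square-integrable smooth sections of `Λ(E*)`. -/
def L2Sections [MeasurableSpace E] [BorelSpace E] : Submodule 𝕜 (Sections 𝕜 E) where
  carrier := {u | MemLp (u : E → Forms 𝕜 E) 2 volume}
  add_mem' hu hv := MemLp.add hu hv
  zero_mem' := MemLp.zero
  smul_mem' a _ hu := MemLp.const_smul hu a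

end

end WittenDirac

/-! Write `A_i = ∇_i + T x_i` and `B_i = -∇_i + T x_i`. Sorting `c(e_i)` and `c̃(e_i)` into wedge
and contraction parts gives `D + T c̃(Z) τ* = ∑ (e_i* ∧ A_i + i_{e_i} B_i)` (`deformedDirac_eq`).
The fermionic and bosonic commutation relations make its square `H + 2T N`, where `H = ∑ B_i A_i` is
the shifted harmonic oscillator and `N` the degree operator (`deformedDirac_sq`). Hence the degree
`k` part of an eigensection for `μ` is an eigensection of `H` for `μ² - 2Tk`
(`oscillator_degreeProj`).

Two facts about `H` on square-integrable sections finish the argument. It has no negative eigenvalue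
(`eq_zero_of_oscillator_neg`), so for `μ² < 2T` only degree 0 survives. Each `A_i` lowers
eigenvalues by `2T`, so an eigensection for `ν < 2T` is killed by every `A_i`
(`annihilation_eq_zero_of_lt`). Then `H` kills it too, forcing `ν = 0`, and the equations `A_i u =
0` integrate to a Gaussian.

No self-adjoint extension is used: positivity, and square integrability of `A_i u`, come from
integration by parts against cutoffs, applied to real-valued components. -/

namespace WittenDirac

noncomputable section

/-! ### Localized energy estimates for scalar functions. -/

section Analysis

variable {E : Type*} [NormedAddCommGroup E] [InnerProductSpace ℝ E] [FiniteDimensional ℝ E]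
  [MeasurableSpace E] [BorelSpace E]

theorem integral_fderiv_eq_zero {F : E → ℝ} (hF : ContDiff ℝ 1 F) (hc : HasCompactSupport F)
    (v : E) : ∫ x, fderiv ℝ F x v = 0 := by
  have hd : Continuous fun x => fderiv ℝ F x v :=
    (hF.continuous_fderiv (by simp)).clm_apply continuous_const
  have h := integral_mul_fderiv_eq_neg_fderiv_mul_of_integrable (μ := (volume : Measure E))
    (f := fun _ : E => (1 : ℝ)) (g := F) (v := v) (by simp)
    (by simpa using hd.integrable_of_hasCompactSupport (hc.fderiv_apply ℝ v))
    (by simpa using hF.continuous.integrable_of_hasCompactSupport hc)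
    (by fun_prop) (fun x _ => hF.differentiable (by simp) x)
  simpa using h

/-- The energy estimate for `∑ i, (-∂_i + T x_i) (∂_i + T x_i) f = ν f`, localized by a cutoff. -/
theorem cutoff_energy_le {ι : Type*} [Fintype ι] {e : ι → E} {T ν : ℝ} {f : E → ℝ}
    {g : ι → E → ℝ} (hf : ContDiff ℝ 1 f) (hg : ∀ i, ContDiff ℝ 1 (g i))
    (hA : ∀ i x, fderiv ℝ f x (e i) + T * (inner ℝ (e i) x * f x) = g i x)
    (hB : ∀ x, ∑ i, (-fderiv ℝ (g i) x (e i) + T * (inner ℝ (e i) x * g i x)) = ν * f x)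
    {χ : E → ℝ} (hχ : ContDiff ℝ 1 χ) (hc : HasCompactSupport χ) :
    ∫ x, (χ x ^ 2 * ∑ i, g i x ^ 2) / 2 ≤
      ∫ x, (ν * (χ x ^ 2 * f x ^ 2) + 2 * ((∑ i, fderiv ℝ χ x (e i) ^ 2) * f x ^ 2)) := by
  -- The vector field `χ² f g` has compact support, so its divergence integrates to zero and may be
  -- added to the right-hand side.
  set F : ι → E → ℝ := fun i x => χ x * (χ x * (f x * g i x)) with hFdef
  have hF : ∀ i, ContDiff ℝ 1 (F i) := fun i => hχ.mul (hχ.mul (hf.mul (hg i)))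
  have hFc : ∀ i, HasCompactSupport (F i) := fun i => hc.mul_right
  have hχ' : ∀ i, Continuous fun x => fderiv ℝ χ x (e i) := fun i =>
    (hχ.continuous_fderiv (by simp)).clm_apply continuous_const
  have hFi : ∀ i, Integrable fun x => fderiv ℝ (F i) x (e i) := fun i =>
    (((hF i).continuous_fderiv (by simp)).clm_apply
      continuous_const).integrable_of_hasCompactSupport ((hFc i).fderiv_apply ℝ (e i))
  have hdF : ∀ i x, fderiv ℝ (F i) x (e i) = 2 * χ x * fderiv ℝ χ x (e i) * f x * g i x
      + χ x ^ 2 * fderiv ℝ f x (e i) * g i x + χ x ^ 2 * f x * fderiv ℝ (g i) x (e i) := by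
    intro i x
    have h1 := (hχ.differentiable (by simp) x).hasFDerivAt
    have h2 := (hf.differentiable (by simp) x).hasFDerivAt
    have h3 := ((hg i).differentiable (by simp) x).hasFDerivAt
    have h := h1.mul (h1.mul (h2.mul h3))
    have h' : fderiv ℝ (F i) x = _ := h.fderiv
    rw [h']
    simp
    ring
  have hzero : ∫ x, ∑ i, fderiv ℝ (F i) x (e i) = 0 := by
    rw [integral_finsetSum _ fun i _ => hFi i]
    exact Finset.sum_eq_zero fun i _ => integral_fderiv_eq_zero (hF i) (hFc i) (e i)
  have hpt : ∀ x, (χ x ^ 2 * ∑ i, g i x ^ 2) / 2 ≤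
      (ν * (χ x ^ 2 * f x ^ 2) + 2 * ((∑ i, fderiv ℝ χ x (e i) ^ 2) * f x ^ 2))
        + ∑ i, fderiv ℝ (F i) x (e i) := by
    intro x
    have h1 : ν * (χ x ^ 2 * f x ^ 2) = ∑ i, χ x ^ 2 * f x *
        (-fderiv ℝ (g i) x (e i) + T * (inner ℝ (e i) x * g i x)) := by
      rw [← Finset.mul_sum, hB]; ring
    rw [h1, Finset.mul_sum, Finset.sum_div, Finset.sum_mul, Finset.mul_sum,
      ← Finset.sum_add_distrib, ← Finset.sum_add_distrib]
    refine Finset.sum_le_sum fun i _ => ?_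
    rw [hdF, show fderiv ℝ f x (e i) = g i x - T * (inner ℝ (e i) x * f x) by rw [← hA]; ring]
    -- After substitution the two sides differ by `χ² g² / 2 + 2 χ χ' f g + 2 χ'² f²`, which is half
    -- this square.
    nlinarith [sq_nonneg (χ x * g i x + 2 * (fderiv ℝ χ x (e i) * f x))]
  have hI1 : Integrable fun x => (χ x ^ 2 * ∑ i, g i x ^ 2) / 2 := by
    refine Continuous.integrable_of_hasCompactSupport ?_ ?_
    · have := hχ.continuous
      have := fun i => (hg i).continuous
      fun_prop
    · refine hc.mono' ?_
      refine (Function.support_subset_iff'.2 fun x hx => ?_).trans subset_closure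
      simp [Function.notMem_support.1 hx]
  have hI2 : Integrable fun x =>
      (ν * (χ x ^ 2 * f x ^ 2) + 2 * ((∑ i, fderiv ℝ χ x (e i) ^ 2) * f x ^ 2)) := by
    refine Continuous.integrable_of_hasCompactSupport ?_ ?_
    · have := hχ.continuous
      have := hf.continuous
      fun_prop
    · refine hc.mono' (Function.support_subset_iff'.2 fun x hx => ?_)
      have h0 : χ x = 0 := image_eq_zero_of_notMem_tsupport hx
      have h1 : fderiv ℝ χ x = 0 :=
        Function.notMem_support.1 fun h => hx (support_fderiv_subset ℝ h)
      simp [h0, h1]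
  calc _ ≤ ∫ x, ((ν * (χ x ^ 2 * f x ^ 2) + 2 * ((∑ i, fderiv ℝ χ x (e i) ^ 2) * f x ^ 2))
        + ∑ i, fderiv ℝ (F i) x (e i)) :=
        integral_mono hI1 (hI2.add (integrable_finsetSum _ fun i _ => hFi i)) hpt
    _ = _ := by rw [integral_add hI2 (integrable_finsetSum _ fun i _ => hFi i), hzero, add_zero]

/-- Smooth cutoffs at scale `R`, with derivative `O(1 / R)`. -/
theorem exists_cutoff (E : Type*) [NormedAddCommGroup E] [InnerProductSpace ℝ E]
    [FiniteDimensional ℝ E] : ∃ M : ℝ, ∀ R : ℝ, 0 < R → ∃ χ : E → ℝ, ContDiff ℝ 1 χ ∧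
    HasCompactSupport χ ∧ (∀ x, 0 ≤ χ x ∧ χ x ≤ 1) ∧ (∀ x ∈ Metric.closedBall 0 R, χ x = 1) ∧
    ∀ x, ‖fderiv ℝ χ x‖ ≤ M / R := by
  let b : ContDiffBump (0 : E) := ⟨1, 2, one_pos, one_lt_two⟩
  have hb : ContDiff ℝ 1 b := b.contDiff
  obtain ⟨M, hM⟩ := (hb.continuous_fderiv (by simp)).bounded_above_of_compact_support
    (b.hasCompactSupport.fderiv ℝ)
  refine ⟨M, fun R hR => ⟨fun x => b (R⁻¹ • x), hb.comp (contDiff_const_smul _),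
    b.hasCompactSupport.comp_smul (inv_ne_zero hR.ne'), fun x => ⟨b.nonneg, b.le_one⟩,
    fun x hx => b.one_of_mem_closedBall ?_, fun x => ?_⟩⟩
  · rw [mem_closedBall_zero_iff] at hx ⊢
    rw [norm_smul, norm_inv, Real.norm_of_nonneg hR.le]
    change R⁻¹ * ‖x‖ ≤ 1
    rw [inv_mul_le_iff₀ hR]; linarith
  · rw [fderiv_comp_smul, norm_smul, norm_inv, Real.norm_of_nonneg hR.le, div_eq_inv_mul]
    exact mul_le_mul_of_nonneg_left (hM _) (by positivity)

/-- The cutoff error is `O(1 / R²)` since `f` is square-integrable. The term `∫ χ² f²` is kept so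
that both signs of `ν` can be exploited: it lies between the integral of `f²` over the ball and over
`E`. -/
theorem exists_energy_le_closedBall {ι : Type*} [Fintype ι] {e : ι → E} {T ν : ℝ} {f : E → ℝ}
    {g : ι → E → ℝ} (hf : ContDiff ℝ 1 f) (hg : ∀ i, ContDiff ℝ 1 (g i))
    (hf2 : Integrable fun x => f x ^ 2)
    (hA : ∀ i x, fderiv ℝ f x (e i) + T * (inner ℝ (e i) x * f x) = g i x)
    (hB : ∀ x, ∑ i, (-fderiv ℝ (g i) x (e i) + T * (inner ℝ (e i) x * g i x)) = ν * f x) :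
    ∃ M : ℝ, ∀ R : ℝ, 0 < R → ∃ χ : E → ℝ, (∀ x, 0 ≤ χ x ∧ χ x ≤ 1) ∧
      (∀ x ∈ Metric.closedBall 0 R, χ x = 1) ∧ (Integrable fun x => χ x ^ 2 * f x ^ 2) ∧
      ∫ x in Metric.closedBall (0 : E) R, (∑ i, g i x ^ 2) ≤
        2 * ν * (∫ x, χ x ^ 2 * f x ^ 2) + M / R ^ 2 := by
  obtain ⟨M, hM⟩ := exists_cutoff E
  refine ⟨4 * (∑ i, (M * ‖e i‖) ^ 2) * ∫ x, f x ^ 2, fun R hR => ?_⟩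
  obtain ⟨χ, hχ, hc, h01, h1, hd⟩ := hM R hR
  have hgc : Continuous fun x => ∑ i, g i x ^ 2 := by
    have := fun i => (hg i).continuous
    fun_prop
  have hχc := hχ.continuous
  have hfc := hf.continuous
  have hχ' : ∀ i, Continuous fun x => fderiv ℝ χ x (e i) := fun i =>
    (hχ.continuous_fderiv (by simp)).clm_apply continuous_const
  have hi1 : Integrable fun x => χ x ^ 2 * f x ^ 2 := by
    refine hf2.mono' (by fun_prop) (ae_of_all _ fun x => ?_)
    rw [Real.norm_of_nonneg (by positivity)]
    have := h01 x
    exact mul_le_of_le_one_left (by positivity) (pow_le_one₀ this.1 this.2)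
  have hbd : ∀ x, (∑ i, fderiv ℝ χ x (e i) ^ 2) * f x ^ 2 ≤
      ((∑ i, (M * ‖e i‖) ^ 2) / R ^ 2) * f x ^ 2 := by
    intro x
    refine mul_le_mul_of_nonneg_right ?_ (by positivity)
    rw [Finset.sum_div]
    refine Finset.sum_le_sum fun i _ => ?_
    rw [← div_pow, ← sq_abs (fderiv ℝ χ x (e i))]
    refine pow_le_pow_left₀ (abs_nonneg _) ?_ 2
    calc |fderiv ℝ χ x (e i)| ≤ ‖fderiv ℝ χ x‖ * ‖e i‖ := (fderiv ℝ χ x).le_opNorm _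
      _ ≤ M / R * ‖e i‖ := by gcongr; exact hd x
      _ = _ := by ring
  have hi2 : Integrable fun x => (∑ i, fderiv ℝ χ x (e i) ^ 2) * f x ^ 2 := by
    refine (hf2.const_mul ((∑ i, (M * ‖e i‖) ^ 2) / R ^ 2)).mono' (by fun_prop)
      (ae_of_all _ fun x => ?_)
    rw [Real.norm_of_nonneg (by positivity)]
    exact hbd x
  have hi3 : Integrable fun x => χ x ^ 2 * ∑ i, g i x ^ 2 := by
    refine Continuous.integrable_of_hasCompactSupport (by fun_prop) ?_
    refine hc.mono' ((Function.support_subset_iff'.2 fun x hx => ?_).trans subset_closure)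
    simp [Function.notMem_support.1 hx]
  refine ⟨χ, h01, h1, hi1, ?_⟩
  have key := cutoff_energy_le hf hg hA hB hχ hc
  rw [integral_div, integral_add (hi1.const_mul _) (hi2.const_mul _), integral_const_mul,
    integral_const_mul] at key
  have h2 : ∫ x, (∑ i, fderiv ℝ χ x (e i) ^ 2) * f x ^ 2 ≤
      ((∑ i, (M * ‖e i‖) ^ 2) / R ^ 2) * ∫ x, f x ^ 2 := by
    rw [← integral_const_mul]
    exact integral_mono hi2 (hf2.const_mul _) hbd
  have h3 : ∫ x in Metric.closedBall (0 : E) R, (∑ i, g i x ^ 2) ≤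
      ∫ x, χ x ^ 2 * ∑ i, g i x ^ 2 := by
    calc _ = ∫ x in Metric.closedBall (0 : E) R, χ x ^ 2 * ∑ i, g i x ^ 2 :=
          setIntegral_congr_fun measurableSet_closedBall fun x hx => by simp [h1 x hx]
      _ ≤ _ := setIntegral_le_integral hi3 (ae_of_all _ fun x => by positivity)
  have h4 : 4 * (∑ i, (M * ‖e i‖) ^ 2) * (∫ x, f x ^ 2) / R ^ 2 =
    4 * (((∑ i, (M * ‖e i‖) ^ 2) / R ^ 2) * ∫ x, f x ^ 2) := by ring
  rw [h4]
  linarith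

/-- For `R ≥ 1` the ball estimate is bounded independently of `R`; exhaust `E` by balls. This allows
the absence of negative eigenvalues to be applied to `A_i u` in turn. -/
theorem integrable_sq_of_energy {ι : Type*} [Fintype ι] {e : ι → E} {T ν : ℝ} {f : E → ℝ}
    {g : ι → E → ℝ} (hf : ContDiff ℝ 1 f) (hg : ∀ i, ContDiff ℝ 1 (g i))
    (hf2 : Integrable fun x => f x ^ 2)
    (hA : ∀ i x, fderiv ℝ f x (e i) + T * (inner ℝ (e i) x * f x) = g i x)
    (hB : ∀ x, ∑ i, (-fderiv ℝ (g i) x (e i) + T * (inner ℝ (e i) x * g i x)) = ν * f x)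
    (i : ι) : Integrable fun x => g i x ^ 2 := by
  obtain ⟨M, hM⟩ := exists_energy_le_closedBall hf hg hf2 hA hB
  have hgc : Continuous fun x => ∑ i, g i x ^ 2 := by
    have := fun i => (hg i).continuous
    fun_prop
  have hsum : Integrable fun x => ∑ i, g i x ^ 2 := by
    refine (aecover_closedBall (μ := (volume : Measure E)) (x := (0 : E))
      Filter.tendsto_id).integrable_of_integral_norm_bounded
      (2 * |ν| * (∫ x, f x ^ 2) + |M|)
      (fun R => hgc.continuousOn.integrableOn_compact (isCompact_closedBall _ _)) ?_
    filter_upwards [Filter.eventually_ge_atTop 1] with R hR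
    obtain ⟨χ, h01, -, hi, h⟩ := hM R (by linarith)
    have h1 : ∫ x, χ x ^ 2 * f x ^ 2 ≤ ∫ x, f x ^ 2 := integral_mono hi hf2 fun x =>
      mul_le_of_le_one_left (sq_nonneg _) (pow_le_one₀ (h01 x).1 (h01 x).2)
    have h0 : 0 ≤ ∫ x, χ x ^ 2 * f x ^ 2 := integral_nonneg fun x => by positivity
    have h2 : M / R ^ 2 ≤ |M| := by
      rw [div_le_iff₀ (by positivity)]
      nlinarith [le_abs_self M, mul_le_mul_of_nonneg_left (one_le_pow₀ (n := 2) hR) (abs_nonneg M)]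
    have h3 : ν * (∫ x, χ x ^ 2 * f x ^ 2) ≤ |ν| * ∫ x, f x ^ 2 :=
      mul_le_mul (le_abs_self _) h1 h0 (abs_nonneg _)
    calc _ = ∫ x in Metric.closedBall (0 : E) R, (∑ i, g i x ^ 2) := by
          refine integral_congr_ae (ae_of_all _ fun x => ?_)
          exact Real.norm_of_nonneg (by positivity)
      _ ≤ _ := h.trans (by linarith)
  refine hsum.mono' ((hg i).continuous.pow 2).aestronglyMeasurable (ae_of_all _ fun x => ?_)
  rw [Real.norm_of_nonneg (by positivity)]
  exact Finset.single_le_sum (f := fun i => g i x ^ 2) (fun i _ => sq_nonneg _)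
    (Finset.mem_univ i)

/-- The energy is nonnegative, so for `ν < 0` the ball estimate bounds `∫ f²` over the ball by a
multiple of `1 / R²`. Let `R → ∞`; continuity turns almost everywhere into everywhere. -/
theorem eq_zero_of_energy_neg {ι : Type*} [Fintype ι] {e : ι → E} {T ν : ℝ} {f : E → ℝ}
    {g : ι → E → ℝ} (hf : ContDiff ℝ 1 f) (hg : ∀ i, ContDiff ℝ 1 (g i))
    (hf2 : Integrable fun x => f x ^ 2)
    (hA : ∀ i x, fderiv ℝ f x (e i) + T * (inner ℝ (e i) x * f x) = g i x)
    (hB : ∀ x, ∑ i, (-fderiv ℝ (g i) x (e i) + T * (inner ℝ (e i) x * g i x)) = ν * f x)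
    (hν : ν < 0) : f = 0 := by
  obtain ⟨M, hM⟩ := exists_energy_le_closedBall hf hg hf2 hA hB
  have hlim := (aecover_closedBall (μ := (volume : Measure E)) (x := (0 : E))
      Filter.tendsto_id).integral_tendsto_of_countably_generated hf2
  have hle : ∀ᶠ R : ℝ in Filter.atTop,
      ∫ x in Metric.closedBall (0 : E) (id R), f x ^ 2 ≤ M / (2 * -ν) / R ^ 2 := by
    filter_upwards [Filter.eventually_gt_atTop 0] with R hR
    obtain ⟨χ, h01, h1, hi, h⟩ := hM R hR
    have h2 : ∫ x in Metric.closedBall (0 : E) R, f x ^ 2 ≤ ∫ x, χ x ^ 2 * f x ^ 2 := by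
      calc _ = ∫ x in Metric.closedBall (0 : E) R, χ x ^ 2 * f x ^ 2 :=
            setIntegral_congr_fun measurableSet_closedBall fun x hx => by simp [h1 x hx]
        _ ≤ _ := setIntegral_le_integral hi (ae_of_all _ fun x => by positivity)
    have h3 : 0 ≤ ∫ x in Metric.closedBall (0 : E) R, (∑ i, g i x ^ 2) :=
      integral_nonneg fun x => by positivity
    rw [div_right_comm, le_div_iff₀ (by linarith), id]
    nlinarith
  have hM0 : Filter.Tendsto (fun R : ℝ => M / (2 * -ν) / R ^ 2) Filter.atTop (nhds 0) :=
    tendsto_const_nhds.div_atTop (Filter.tendsto_pow_atTop two_ne_zero)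
  have hint : ∫ x, f x ^ 2 = 0 :=
    le_antisymm (le_of_tendsto_of_tendsto hlim hM0 hle) (integral_nonneg fun x => sq_nonneg _)
  rw [integral_eq_zero_iff_of_nonneg (fun x => sq_nonneg _) hf2] at hint
  have h := (Continuous.ae_eq_iff_eq volume (hf.continuous.pow 2) continuous_zero).1 hint
  funext x
  simpa using congrFun h x

end Analysis

/-! ### Commutator algebra in a ring. -/

section Abstract

variable {R ι : Type*} [Ring R] [Fintype ι]

theorem sum_sum_eq_zero_of_antisymm [IsAddTorsionFree R] {F : ι → ι → R}
    (h : ∀ i j, F i j = -F j i) : ∑ i, ∑ j, F i j = 0 := by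
  rw [← self_eq_neg, ← Finset.sum_neg_distrib]
  conv_lhs => rw [Finset.sum_comm]
  refine Finset.sum_congr rfl fun i _ => ?_
  rw [← Finset.sum_neg_distrib]
  exact Finset.sum_congr rfl fun j _ => h j i

/-- The square of a Dirac type operator built from fermionic operators `W`, `I` and bosonic
operators `A`, `B`. -/
theorem sq_sum_fermion_boson [IsAddTorsionFree R] [DecidableEq ι] {W I A B : ι → R} {c : R}
    (hWW : ∀ i j, W i * W j = -(W j * W i)) (hII : ∀ i j, I i * I j = -(I j * I i))
    (hIW : ∀ i j, I i * W j = (if i = j then 1 else 0) - W j * I i)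
    (hAA : ∀ i j, A i * A j = A j * A i) (hBB : ∀ i j, B i * B j = B j * B i)
    (hAB : ∀ i j, A i * B j = B j * A i + if i = j then c else 0)
    (hAW : ∀ i j, A i * W j = W j * A i) (hAI : ∀ i j, A i * I j = I j * A i)
    (hBW : ∀ i j, B i * W j = W j * B i) (hBI : ∀ i j, B i * I j = I j * B i) :
    (∑ i, (W i * A i + I i * B i)) * ∑ i, (W i * A i + I i * B i) =
      ∑ i, B i * A i + (∑ i, W i * I i) * c := by
  -- Normal order each product, fermions to the left. The `W W`, `I I` and mixed parts are
  -- antisymmetric in `(i, j)` and cancel in the double sum; the diagonal terms remain.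
  have hterm : ∀ i j, (W i * A i + I i * B i) * (W j * A j + I j * B j) =
      W i * W j * (A i * A j) + I i * I j * (B i * B j) +
        ((if i = j then B i * A j else 0) + (if i = j then W i * I j * c else 0)) +
        (W i * I j * (B j * A i) - W j * I i * (B i * A j)) := by
    intro i j
    have h1 : W i * A i * (W j * A j) = W i * W j * (A i * A j) := by
      rw [mul_assoc, ← mul_assoc (A i), hAW]; noncomm_ring
    have h2 : I i * B i * (I j * B j) = I i * I j * (B i * B j) := by
      rw [mul_assoc, ← mul_assoc (B i), hBI]; noncomm_ring
    have h3 : W i * A i * (I j * B j) =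
        W i * I j * (B j * A i) + if i = j then W i * I j * c else 0 := by
      rw [mul_assoc, ← mul_assoc (A i), hAI, mul_assoc, hAB, ← mul_assoc, mul_add, mul_ite,
        mul_zero]
    have h4 : I i * B i * (W j * A j) =
        (if i = j then B i * A j else 0) - W j * I i * (B i * A j) := by
      rw [mul_assoc, ← mul_assoc (B i), hBW, mul_assoc, ← mul_assoc, hIW, sub_mul, ite_mul,
        zero_mul, one_mul]
    rw [add_mul, mul_add, mul_add, h1, h2, h3, h4]
    abel
  rw [Finset.sum_mul_sum]
  simp_rw [hterm, Finset.sum_add_distrib]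
  rw [sum_sum_eq_zero_of_antisymm (F := fun i j => W i * W j * (A i * A j)),
    sum_sum_eq_zero_of_antisymm (F := fun i j => I i * I j * (B i * B j)),
    sum_sum_eq_zero_of_antisymm
      (F := fun i j => W i * I j * (B j * A i) - W j * I i * (B i * A j))]
  · simp [Finset.sum_mul]
  · intro i j; abel
  · intro i j; rw [hII, hBB, neg_mul]
  · intro i j; rw [hWW, hAA, neg_mul]

/-- The ladder relation: for scalar `c`, `A i` sends an eigenvector of `∑ B j * A j` for `ν` to one
for `ν - c`, or to zero. -/
theorem sum_mul_ladder [DecidableEq ι] {A B : ι → R} {c : R}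
    (hAA : ∀ i j, A i * A j = A j * A i)
    (hAB : ∀ i j, A i * B j = B j * A i + if i = j then c else 0) (i : ι) :
    (∑ j, B j * A j) * A i = A i * (∑ j, B j * A j) - c * A i := by
  have h : ∀ j, A i * (B j * A j) = B j * A j * A i + if i = j then c * A j else 0 := by
    intro j
    rw [← mul_assoc, hAB, add_mul, mul_assoc, hAA, ite_mul, zero_mul, mul_assoc]
  simp [Finset.mul_sum, Finset.sum_mul, h, Finset.sum_add_distrib]

end Abstract

/-! ### Wedge, contraction and degree on the fibre. -/

section Fibre

variable {𝕜 E : Type*} [RCLike 𝕜] [NormedAddCommGroup E] [InnerProductSpace ℝ E]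

theorem wedge_apply (v : E) (w : Forms 𝕜 E) :
    wedge 𝕜 v w = ExteriorAlgebra.ι 𝕜 (flat 𝕜 v) * w := rfl

theorem interior_ι_mul (v : E) (f : E →ₗ[ℝ] 𝕜) (w : Forms 𝕜 E) :
    interior 𝕜 v (ExteriorAlgebra.ι 𝕜 f * w) =
      f v • w - ExteriorAlgebra.ι 𝕜 f * interior 𝕜 v w :=
  CliffordAlgebra.contractLeft_ι_mul (Q := (0 : QuadraticForm 𝕜 (E →ₗ[ℝ] 𝕜))) (evalAt 𝕜 v) f w

theorem wedge_wedge (v v' : E) (w : Forms 𝕜 E) :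
    wedge 𝕜 v (wedge 𝕜 v' w) = -wedge 𝕜 v' (wedge 𝕜 v w) := by
  simp only [wedge_apply, ← mul_assoc]
  rw [eq_neg_of_add_eq_zero_left (ExteriorAlgebra.ι_add_mul_swap (R := 𝕜) (flat 𝕜 v) (flat 𝕜 v')),
    neg_mul]

theorem interior_interior (v v' : E) (w : Forms 𝕜 E) :
    interior 𝕜 v (interior 𝕜 v' w) = -interior 𝕜 v' (interior 𝕜 v w) :=
  CliffordAlgebra.contractLeft_comm (Q := (0 : QuadraticForm 𝕜 (E →ₗ[ℝ] 𝕜))) _ _ w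

theorem flat_apply (v v' : E) : flat 𝕜 v v' = (inner ℝ v v' : ℝ) := rfl

theorem interior_wedge (v v' : E) (w : Forms 𝕜 E) :
    interior 𝕜 v (wedge 𝕜 v' w) = ((inner ℝ v' v : ℝ) : 𝕜) • w - wedge 𝕜 v' (interior 𝕜 v w) :=
  interior_ι_mul v (flat 𝕜 v') w

theorem sum_smul_flat {ι : Type*} [Fintype ι] (e : OrthonormalBasis ι ℝ E) (f : E →ₗ[ℝ] 𝕜) :
    ∑ i, f (e i) • flat 𝕜 (e i) = f := by
  classical
  refine e.toBasis.ext fun j => ?_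
  simp [flat_apply, orthonormal_iff_ite.1 e.orthonormal]

theorem exists_algebraMap_of_mem_zero {w : Forms 𝕜 E} (hw : w ∈ ⋀[𝕜]^0 (E →ₗ[ℝ] 𝕜)) :
    ∃ a : 𝕜, algebraMap 𝕜 (Forms 𝕜 E) a = w := by
  rw [ExteriorAlgebra.exteriorPower, pow_zero, Submodule.one_eq_range] at hw
  exact hw

/-- The number operator acts by `k` on forms of degree `k`. -/
theorem sum_wedge_interior {ι : Type*} [Fintype ι] (e : OrthonormalBasis ι ℝ E) (k : ℕ)
    (w : Forms 𝕜 E) (hw : w ∈ ⋀[𝕜]^k (E →ₗ[ℝ] 𝕜)) :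
    ∑ i, wedge 𝕜 (e i) (interior 𝕜 (e i) w) = (k : 𝕜) • w := by
  induction k generalizing w with
  | zero =>
    obtain ⟨a, rfl⟩ := exists_algebraMap_of_mem_zero hw
    have : ∀ i, interior 𝕜 (e i) (algebraMap 𝕜 (Forms 𝕜 E) a) = 0 := fun i =>
      CliffordAlgebra.contractLeft_algebraMap (Q := (0 : QuadraticForm 𝕜 (E →ₗ[ℝ] 𝕜))) _ a
    simp [this]
  | succ k ih =>
    rw [ExteriorAlgebra.exteriorPower, pow_succ'] at hw
    induction hw using Submodule.mul_induction_on' with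
    | mem_mul_mem m hm n hn =>
      obtain ⟨f, rfl⟩ := hm
      -- The sign from the antiderivation rule cancels the sign from moving `e_i*` past `f`, so the
      -- number operator is a derivation. Summing `f(e_i) e_i*` gives back `f`: each factor
      -- contributes 1.
      have h : ∀ i, wedge 𝕜 (e i) (interior 𝕜 (e i) (ExteriorAlgebra.ι 𝕜 f * n)) =
          ExteriorAlgebra.ι 𝕜 (f (e i) • flat 𝕜 (e i)) * n +
            ExteriorAlgebra.ι 𝕜 f * wedge 𝕜 (e i) (interior 𝕜 (e i) n) := by
        intro i
        rw [interior_ι_mul, map_sub, map_smul]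
        simp only [wedge_apply, ← mul_assoc, map_smul, smul_mul_assoc]
        rw [eq_neg_of_add_eq_zero_left
          (ExteriorAlgebra.ι_add_mul_swap (R := 𝕜) (flat 𝕜 (e i)) f), neg_mul, sub_neg_eq_add]
      simp_rw [h, Finset.sum_add_distrib, ← Finset.mul_sum, ← Finset.sum_mul, ← map_sum]
      rw [sum_smul_flat, ih n hn, mul_smul_comm]
      push_cast
      rw [add_smul, one_smul, add_comm]
    | add x _ y _ hx hy => simp only [map_add, Finset.sum_add_distrib, hx, hy, smul_add]

/-- The projection of `Λ(E*)` onto the forms of degree `k`. -/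
def degreeProj (𝕜 E : Type*) [RCLike 𝕜] [NormedAddCommGroup E] [InnerProductSpace ℝ E] (k : ℕ) :
    Forms 𝕜 E →ₗ[𝕜] Forms 𝕜 E :=
  GradedAlgebra.proj (fun i : ℕ => ⋀[𝕜]^i (E →ₗ[ℝ] 𝕜)) k

theorem degreeProj_mem (k : ℕ) (w : Forms 𝕜 E) : degreeProj 𝕜 E k w ∈ ⋀[𝕜]^k (E →ₗ[ℝ] 𝕜) :=
  SetLike.coe_mem _

theorem degreeProj_of_mem {k : ℕ} (l : ℕ) {w : Forms 𝕜 E} (hw : w ∈ ⋀[𝕜]^k (E →ₗ[ℝ] 𝕜)) :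
    degreeProj 𝕜 E l w = if l = k then w else 0 := by
  split_ifs with h
  · subst h
    exact DirectSum.decompose_of_mem_same (fun i : ℕ => ⋀[𝕜]^i (E →ₗ[ℝ] 𝕜)) hw
  · exact DirectSum.decompose_of_mem_ne (fun i : ℕ => ⋀[𝕜]^i (E →ₗ[ℝ] 𝕜)) hw (Ne.symm h)

theorem eq_zero_of_degreeProj {w : Forms 𝕜 E} (h : ∀ k, degreeProj 𝕜 E k w = 0) : w = 0 := by
  have h0 : DirectSum.decompose (fun i : ℕ => ⋀[𝕜]^i (E →ₗ[ℝ] 𝕜)) w = 0 :=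
    DFinsupp.ext fun k => Subtype.ext (h k)
  exact (DirectSum.decomposeAddEquiv (fun i : ℕ => ⋀[𝕜]^i (E →ₗ[ℝ] 𝕜))).map_eq_zero_iff.1 h0

theorem degreeProj_sum_wedge_interior {ι : Type*} [Fintype ι] (e : OrthonormalBasis ι ℝ E) (k : ℕ)
    (w : Forms 𝕜 E) : degreeProj 𝕜 E k (∑ i, wedge 𝕜 (e i) (interior 𝕜 (e i) w)) =
      (k : 𝕜) • degreeProj 𝕜 E k w := by
  induction w using DirectSum.Decomposition.inductionOn (fun i : ℕ => ⋀[𝕜]^i (E →ₗ[ℝ] 𝕜)) with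
  | zero => simp
  | homogeneous m =>
    rw [sum_wedge_interior e _ _ m.2, map_smul, degreeProj_of_mem k m.2]
    split_ifs with h
    · rw [h]
    · simp
  | add x y hx hy => simp only [map_add, Finset.sum_add_distrib, hx, hy, smul_add]

end Fibre

/-! ### Creation and annihilation operators; the square of the deformed operator. -/

section Operators

variable {𝕜 E : Type*} [RCLike 𝕜] [NormedAddCommGroup E] [InnerProductSpace ℝ E]
  [FiniteDimensional ℝ E]

theorem section_ext {u v : Sections 𝕜 E} (h : ∀ x, (u : E → Forms 𝕜 E) x = (v : E → Forms 𝕜 E) x) :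
    u = v := Subtype.ext (funext h)

/-- Multiplication of sections by the linear function `x ↦ ⟪v, x⟫`. -/
def coordMul (𝕜 : Type*) {E : Type*} [RCLike 𝕜] [NormedAddCommGroup E] [InnerProductSpace ℝ E]
    [FiniteDimensional ℝ E] (v : E) : End 𝕜 (Sections 𝕜 E) where
  toFun u := ⟨fun x => (inner ℝ v x : ℝ) • (u : E → Forms 𝕜 E) x,
    (contDiff_const.inner ℝ contDiff_id).smul (contDiff_section u)⟩
  map_add' _ _ := section_ext fun _ => smul_add _ _ _
  map_smul' a u := section_ext fun x =>
    smul_comm (inner ℝ v x : ℝ) a ((u : E → Forms 𝕜 E) x)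

theorem applyEnd_apply (A : Forms 𝕜 E →ₗ[𝕜] Forms 𝕜 E) (u : Sections 𝕜 E) (x : E) :
    (applyEnd 𝕜 A u : E → Forms 𝕜 E) x = A ((u : E → Forms 𝕜 E) x) := rfl

theorem section_add_apply (u v : Sections 𝕜 E) (x : E) :
    ((u + v : Sections 𝕜 E) : E → Forms 𝕜 E) x =
      (u : E → Forms 𝕜 E) x + (v : E → Forms 𝕜 E) x := rfl

theorem section_smul_apply (a : 𝕜) (u : Sections 𝕜 E) (x : E) :
    ((a • u : Sections 𝕜 E) : E → Forms 𝕜 E) x = a • (u : E → Forms 𝕜 E) x := rfl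

theorem section_zero_apply (x : E) : ((0 : Sections 𝕜 E) : E → Forms 𝕜 E) x = 0 := rfl

theorem section_sum_apply {ι : Type*} (s : Finset ι) (u : ι → Sections 𝕜 E) (x : E) :
    ((∑ i ∈ s, u i : Sections 𝕜 E) : E → Forms 𝕜 E) x = ∑ i ∈ s, (u i : E → Forms 𝕜 E) x := by
  simp [Finset.sum_apply]

theorem covDeriv_mul_comm (v w : E) :
    covDeriv 𝕜 v * covDeriv 𝕜 w = covDeriv 𝕜 w * covDeriv 𝕜 v := by
  refine LinearMap.ext fun u => section_ext fun x => ?_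
  have hu := contDiff_section u
  have hd : DifferentiableAt ℝ (fderiv ℝ (u : E → Forms 𝕜 E)) x :=
    ((hu.fderiv_right (m := ∞) (by simp)).differentiable (by simp)) x
  have h : ∀ a b : E, fderiv ℝ (fun y => fderiv ℝ (u : E → Forms 𝕜 E) y a) x b =
      fderiv ℝ (fderiv ℝ (u : E → Forms 𝕜 E)) x b a := by
    intro a b
    rw [fderiv_clm_apply hd (differentiableAt_const a)]
    simp
  refine (h w v).trans (Eq.trans ?_ (h v w).symm)
  exact (hu.contDiffAt.isSymmSndFDerivAt (by
    simp only [minSmoothness_of_isRCLikeNormedField]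
    exact WithTop.coe_le_coe.2 (le_top (a := (2 : ℕ∞))))) v w

theorem coordMul_mul_comm (v w : E) :
    coordMul 𝕜 v * coordMul 𝕜 w = coordMul 𝕜 w * coordMul 𝕜 v :=
  LinearMap.ext fun u => section_ext fun x =>
    smul_comm (inner ℝ v x : ℝ) (inner ℝ w x : ℝ) ((u : E → Forms 𝕜 E) x)

theorem covDeriv_mul_coordMul (v w : E) :
    covDeriv 𝕜 v * coordMul 𝕜 w = coordMul 𝕜 w * covDeriv 𝕜 v
      + ((inner ℝ w v : ℝ) : 𝕜) • (1 : End 𝕜 (Sections 𝕜 E)) := by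
  refine LinearMap.ext fun u => section_ext fun x => ?_
  have h1 : HasFDerivAt (fun x : E => (inner ℝ w x : ℝ)) (innerSL ℝ w) x :=
    (innerSL ℝ w).hasFDerivAt
  have h := (h1.smul (differentiableAt_section u x).hasFDerivAt).fderiv
  have h' := congrArg (fun L => L v) h
  refine h'.trans (Eq.trans ?_ (congrArg (fun w => _ + w)
    (RCLike.real_smul_eq_coe_smul (K := 𝕜) (inner ℝ w v : ℝ) ((u : E → Forms 𝕜 E) x))))
  simp
  rfl

theorem covDeriv_mul_applyEnd (v : E) (A : Forms 𝕜 E →ₗ[𝕜] Forms 𝕜 E) :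
    covDeriv 𝕜 v * applyEnd 𝕜 A = applyEnd 𝕜 A * covDeriv 𝕜 v := by
  refine LinearMap.ext fun u => section_ext fun x => ?_
  have h := (((A.restrictScalars ℝ).toContinuousLinearMap.hasFDerivAt).comp x
    (differentiableAt_section u x).hasFDerivAt).fderiv
  exact congrArg (fun L => L v) h

theorem coordMul_mul_applyEnd (v : E) (A : Forms 𝕜 E →ₗ[𝕜] Forms 𝕜 E) :
    coordMul 𝕜 v * applyEnd 𝕜 A = applyEnd 𝕜 A * coordMul 𝕜 v :=
  LinearMap.ext fun u => section_ext fun x =>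
    ((A.restrictScalars ℝ).map_smul (inner ℝ v x : ℝ) ((u : E → Forms 𝕜 E) x)).symm

/-- The annihilation operator `∇_v + T ⟪v, x⟫`. -/
def annihilation (𝕜 : Type*) {E : Type*} [RCLike 𝕜] [NormedAddCommGroup E] [InnerProductSpace ℝ E]
    [FiniteDimensional ℝ E] (T : ℝ) (v : E) : End 𝕜 (Sections 𝕜 E) :=
  covDeriv 𝕜 v + (T : 𝕜) • coordMul 𝕜 v

/-- The creation operator `-∇_v + T ⟪v, x⟫`. -/
def creation (𝕜 : Type*) {E : Type*} [RCLike 𝕜] [NormedAddCommGroup E] [InnerProductSpace ℝ E]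
    [FiniteDimensional ℝ E] (T : ℝ) (v : E) : End 𝕜 (Sections 𝕜 E) :=
  (-1 : 𝕜) • covDeriv 𝕜 v + (T : 𝕜) • coordMul 𝕜 v

theorem annihilation_apply (T : ℝ) (v : E) (u : Sections 𝕜 E) (x : E) :
    (annihilation 𝕜 T v u : E → Forms 𝕜 E) x = fderiv ℝ (u : E → Forms 𝕜 E) x v +
      T • (inner ℝ v x : ℝ) • (u : E → Forms 𝕜 E) x := by
  rw [RCLike.real_smul_eq_coe_smul (K := 𝕜) T]
  rfl

theorem creation_apply (T : ℝ) (v : E) (u : Sections 𝕜 E) (x : E) :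
    (creation 𝕜 T v u : E → Forms 𝕜 E) x = -fderiv ℝ (u : E → Forms 𝕜 E) x v +
      T • (inner ℝ v x : ℝ) • (u : E → Forms 𝕜 E) x := by
  rw [RCLike.real_smul_eq_coe_smul (K := 𝕜) T, ← neg_one_smul 𝕜 (fderiv _ _ _ _)]
  rfl

/-- The cross terms contribute `T ⟪v, w⟫` in either order, so they cancel in the commutator. -/
theorem annihilation_mul_comm (T : ℝ) (v w : E) :
    annihilation 𝕜 T v * annihilation 𝕜 T w = annihilation 𝕜 T w * annihilation 𝕜 T v := by
  simp only [annihilation, add_mul, mul_add, smul_mul_assoc, mul_smul_comm,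
    covDeriv_mul_coordMul, covDeriv_mul_comm v w, coordMul_mul_comm v w, real_inner_comm v w,
    smul_add]
  module

theorem creation_mul_comm (T : ℝ) (v w : E) :
    creation 𝕜 T v * creation 𝕜 T w = creation 𝕜 T w * creation 𝕜 T v := by
  simp only [creation, add_mul, mul_add, smul_mul_assoc, mul_smul_comm,
    covDeriv_mul_coordMul, covDeriv_mul_comm v w, coordMul_mul_comm v w, real_inner_comm v w,
    smul_add]
  module

/-- Because `∇` carries opposite signs in the two factors, the two cross commutators add up. This
`2T` is both the oscillator gap and the weight of the degree operator. -/
theorem annihilation_mul_creation (T : ℝ) (v w : E) :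
    annihilation 𝕜 T v * creation 𝕜 T w = creation 𝕜 T w * annihilation 𝕜 T v
      + ((2 * T * inner ℝ v w : ℝ) : 𝕜) • (1 : End 𝕜 (Sections 𝕜 E)) := by
  have h : ((2 * T * inner ℝ v w : ℝ) : 𝕜) • (1 : End 𝕜 (Sections 𝕜 E)) =
      (T : 𝕜) • ((inner ℝ v w : ℝ) : 𝕜) • (1 : End 𝕜 (Sections 𝕜 E)) +
      (T : 𝕜) • ((inner ℝ v w : ℝ) : 𝕜) • (1 : End 𝕜 (Sections 𝕜 E)) := by
    rw [smul_smul, ← add_smul]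
    congr 1
    push_cast
    ring
  rw [h]
  simp only [annihilation, creation, add_mul, mul_add, smul_mul_assoc, mul_smul_comm, covDeriv_mul_coordMul, covDeriv_mul_comm v w, coordMul_mul_comm v w,
    real_inner_comm v w, smul_add]
  module

theorem annihilation_mul_applyEnd (T : ℝ) (v : E) (A : Forms 𝕜 E →ₗ[𝕜] Forms 𝕜 E) :
    annihilation 𝕜 T v * applyEnd 𝕜 A = applyEnd 𝕜 A * annihilation 𝕜 T v := by
  simp only [annihilation, add_mul, mul_add, smul_mul_assoc, mul_smul_comm,
    covDeriv_mul_applyEnd, coordMul_mul_applyEnd]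

theorem creation_mul_applyEnd (T : ℝ) (v : E) (A : Forms 𝕜 E →ₗ[𝕜] Forms 𝕜 E) :
    creation 𝕜 T v * applyEnd 𝕜 A = applyEnd 𝕜 A * creation 𝕜 T v := by
  simp only [creation, add_mul, mul_add, smul_mul_assoc, mul_smul_comm,
    covDeriv_mul_applyEnd, coordMul_mul_applyEnd]

/-- The harmonic oscillator `-Δ + T² |x|² - T dim E`, in factored form. -/
def oscillator (𝕜 : Type*) {E ι : Type*} [RCLike 𝕜] [NormedAddCommGroup E] [InnerProductSpace ℝ E]
    [FiniteDimensional ℝ E] [Fintype ι] (e : OrthonormalBasis ι ℝ E) (T : ℝ) :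
    End 𝕜 (Sections 𝕜 E) :=
  ∑ i, creation 𝕜 T (e i) * annihilation 𝕜 T (e i)

theorem annihilation_mul_creation_orthonormal {ι : Type*} [Fintype ι] [DecidableEq ι]
    (e : OrthonormalBasis ι ℝ E) (T : ℝ) (i j : ι) :
    annihilation 𝕜 T (e i) * creation 𝕜 T (e j) = creation 𝕜 T (e j) * annihilation 𝕜 T (e i)
      + if i = j then ((2 * T : ℝ) : 𝕜) • (1 : End 𝕜 (Sections 𝕜 E)) else 0 := by
  rw [annihilation_mul_creation, orthonormal_iff_ite.1 e.orthonormal]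
  split_ifs <;> simp

theorem oscillator_annihilation {ι : Type*} [Fintype ι] (e : OrthonormalBasis ι ℝ E)
    (T : ℝ) (i : ι) (u : Sections 𝕜 E) :
    oscillator 𝕜 e T (annihilation 𝕜 T (e i) u) =
      annihilation 𝕜 T (e i) (oscillator 𝕜 e T u) -
        ((2 * T : ℝ) : 𝕜) • annihilation 𝕜 T (e i) u := by
  classical
  have h := sum_mul_ladder (R := End 𝕜 (Sections 𝕜 E))
    (A := fun i => annihilation 𝕜 T (e i)) (B := fun i => creation 𝕜 T (e i)) (fun i j => annihilation_mul_comm (𝕜 := 𝕜) T (e i) (e j))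
    (annihilation_mul_creation_orthonormal (𝕜 := 𝕜) e T) i
  rw [smul_mul_assoc, one_mul] at h
  exact congrArg (fun L : End 𝕜 (Sections 𝕜 E) => L u) h

theorem oscillator_applyEnd {ι : Type*} [Fintype ι] (e : OrthonormalBasis ι ℝ E)
    (T : ℝ) (A : Forms 𝕜 E →ₗ[𝕜] Forms 𝕜 E) (u : Sections 𝕜 E) :
    oscillator 𝕜 e T (applyEnd 𝕜 A u) = applyEnd 𝕜 A (oscillator 𝕜 e T u) := by
  have h : oscillator 𝕜 e T * applyEnd 𝕜 A = applyEnd 𝕜 A * oscillator 𝕜 e T := by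
    rw [oscillator, Finset.sum_mul, Finset.mul_sum]
    refine Finset.sum_congr rfl fun i _ => ?_
    rw [mul_assoc, annihilation_mul_applyEnd, ← mul_assoc, creation_mul_applyEnd, mul_assoc]
  exact congrArg (fun L : End 𝕜 (Sections 𝕜 E) => L u) h

theorem cliffHat_eq_sum {ι : Type*} [Fintype ι] (e : OrthonormalBasis ι ℝ E) (x : E) :
    cliffHat 𝕜 x = ∑ i, (inner ℝ (e i) x : ℝ) • cliffHat 𝕜 (e i) := by
  conv_lhs => rw [← e.sum_repr' x]
  simp

theorem deformedDirac_eq (e : OrthonormalBasis (Fin (finrank ℝ E)) ℝ E) (T : ℝ) :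
    deformedDirac 𝕜 e T = ∑ i, (applyEnd 𝕜 (wedge 𝕜 (e i)) * annihilation 𝕜 T (e i) +
      applyEnd 𝕜 (interior 𝕜 (e i)) * creation 𝕜 T (e i)) := by
  refine LinearMap.ext fun u => section_ext fun x => ?_
  have h1 : (deformedDirac 𝕜 e T u : E → Forms 𝕜 E) x =
      ∑ i, cliff 𝕜 (e i) (fderiv ℝ (u : E → Forms 𝕜 E) x (e i)) +
        T • cliffHat 𝕜 x ((u : E → Forms 𝕜 E) x) := by
    rw [RCLike.real_smul_eq_coe_smul (K := 𝕜) T, deformedDirac, LinearMap.add_apply,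
      section_add_apply, dirac, LinearMap.sum_apply, section_sum_apply]
    rfl
  rw [h1, LinearMap.sum_apply, section_sum_apply, cliffHat_eq_sum e, LinearMap.sum_apply,
    Finset.smul_sum, ← Finset.sum_add_distrib]
  refine Finset.sum_congr rfl fun i _ => ?_
  rw [LinearMap.add_apply, section_add_apply, Module.End.mul_apply, Module.End.mul_apply,
    applyEnd_apply, applyEnd_apply, annihilation_apply, creation_apply]
  have hs : ∀ (A : Forms 𝕜 E →ₗ[𝕜] Forms 𝕜 E) (r : ℝ) (w : Forms 𝕜 E), A (r • w) = r • A w :=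
    fun A r w => (A.restrictScalars ℝ).map_smul r w
  simp only [cliff, cliffHat, LinearMap.sub_apply, LinearMap.add_apply, LinearMap.smul_apply,
    map_add, map_neg, hs, smul_add]
  abel

/-- An instance of `sq_sum_fermion_boson` with `c = 2T`: fibre endomorphisms commute with the
bosonic operators. -/
theorem deformedDirac_sq (e : OrthonormalBasis (Fin (finrank ℝ E)) ℝ E) (T : ℝ)
    (u : Sections 𝕜 E) : deformedDirac 𝕜 e T (deformedDirac 𝕜 e T u) = oscillator 𝕜 e T u +
      ((2 * T : ℝ) : 𝕜) • applyEnd 𝕜 (∑ i, wedge 𝕜 (e i) ∘ₗ interior 𝕜 (e i)) u := by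
  have : IsAddTorsionFree (End 𝕜 (Sections 𝕜 E)) := .of_isTorsionFree 𝕜 _
  have h := sq_sum_fermion_boson (R := End 𝕜 (Sections 𝕜 E))
    (W := fun i => applyEnd 𝕜 (wedge 𝕜 (e i))) (I := fun i => applyEnd 𝕜 (interior 𝕜 (e i)))
    (A := fun i => annihilation 𝕜 T (e i)) (B := fun i => creation 𝕜 T (e i))
    (fun i j => LinearMap.ext fun u => section_ext fun x => wedge_wedge _ _ _)
    (fun i j => LinearMap.ext fun u => section_ext fun x => interior_interior _ _ _)
    (fun i j => LinearMap.ext fun u => section_ext fun x => by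
      refine (interior_wedge (e i) (e j) _).trans ?_
      rw [orthonormal_iff_ite.1 e.orthonormal]
      by_cases h : i = j
      · simp [h]; rfl
      · simp [h, Ne.symm h]; rfl)
    (fun i j => annihilation_mul_comm T _ _) (fun i j => creation_mul_comm T _ _)
    (annihilation_mul_creation_orthonormal e T)
    (fun i j => annihilation_mul_applyEnd T _ _) (fun i j => annihilation_mul_applyEnd T _ _)
    (fun i j => creation_mul_applyEnd T _ _) (fun i j => creation_mul_applyEnd T _ _)
  rw [← deformedDirac_eq] at h
  refine (congrArg (fun L : End 𝕜 (Sections 𝕜 E) => L u) h).trans ?_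
  rw [mul_smul_comm, mul_one]
  refine congrArg (fun w => oscillator 𝕜 e T u + ((2 * T : ℝ) : 𝕜) • w) ?_
  refine section_ext fun x => ?_
  rw [LinearMap.sum_apply, section_sum_apply, applyEnd_apply, LinearMap.sum_apply]
  rfl

/-- An eigensection of the deformed operator decomposes by degree into eigensections of the
harmonic oscillator. -/
theorem oscillator_degreeProj (e : OrthonormalBasis (Fin (finrank ℝ E)) ℝ E) {T μ : ℝ}
    {u : Sections 𝕜 E} (hu : deformedDirac 𝕜 e T u = (μ : 𝕜) • u) (k : ℕ) :
    oscillator 𝕜 e T (applyEnd 𝕜 (degreeProj 𝕜 E k) u) =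
      ((μ ^ 2 - 2 * T * k : ℝ) : 𝕜) • applyEnd 𝕜 (degreeProj 𝕜 E k) u := by
  have h := deformedDirac_sq e T u
  rw [hu, map_smul, hu, ← sub_eq_iff_eq_add] at h
  have h2 : applyEnd 𝕜 (degreeProj 𝕜 E k)
      (applyEnd 𝕜 (∑ i, wedge 𝕜 (e i) ∘ₗ interior 𝕜 (e i)) u) =
      (k : 𝕜) • applyEnd 𝕜 (degreeProj 𝕜 E k) u := by
    refine section_ext fun x => Eq.trans ?_ (degreeProj_sum_wedge_interior e k _)
    rw [applyEnd_apply, applyEnd_apply, LinearMap.sum_apply]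
    rfl
  rw [oscillator_applyEnd, ← h, map_sub, map_smul, map_smul, map_smul, h2, smul_smul, smul_smul,
    ← sub_smul]
  congr 1
  push_cast
  ring

end Operators

/-! ### Low eigenvalues of the oscillator, and the Gaussian. -/

section Spectrum

variable {𝕜 E : Type*} [RCLike 𝕜] [NormedAddCommGroup E] [InnerProductSpace ℝ E]
  [FiniteDimensional ℝ E]

theorem fderiv_functional_comp (ℓ : Forms 𝕜 E →L[ℝ] ℝ) (u : Sections 𝕜 E) (x v : E) :
    fderiv ℝ (fun y => ℓ ((u : E → Forms 𝕜 E) y)) x v =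
      ℓ (fderiv ℝ (u : E → Forms 𝕜 E) x v) := by
  have h := (ℓ.hasFDerivAt.comp x (differentiableAt_section u x).hasFDerivAt).fderiv
  exact congrArg (fun L => L v) h

theorem contDiff_functional_comp (ℓ : Forms 𝕜 E →L[ℝ] ℝ) (u : Sections 𝕜 E) :
    ContDiff ℝ 1 fun y => ℓ ((u : E → Forms 𝕜 E) y) :=
  (ℓ.contDiff.comp (contDiff_section u)).of_le (by simp)

/-- Real functionals commute with differentiation, so they reduce sections to the scalar system of
the energy estimates; this supplies the hypothesis `hA` there, and `functional_oscillator` supplies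
`hB`. -/
theorem functional_annihilation (ℓ : Forms 𝕜 E →L[ℝ] ℝ) (T : ℝ) (v : E) (u : Sections 𝕜 E)
    (x : E) : fderiv ℝ (fun y => ℓ ((u : E → Forms 𝕜 E) y)) x v +
      T * (inner ℝ v x * ℓ ((u : E → Forms 𝕜 E) x)) =
      ℓ ((annihilation 𝕜 T v u : E → Forms 𝕜 E) x) := by
  rw [fderiv_functional_comp, annihilation_apply, map_add, map_smul, map_smul]
  rfl

theorem functional_creation (ℓ : Forms 𝕜 E →L[ℝ] ℝ) (T : ℝ) (v : E) (u : Sections 𝕜 E)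
    (x : E) : -fderiv ℝ (fun y => ℓ ((u : E → Forms 𝕜 E) y)) x v +
      T * (inner ℝ v x * ℓ ((u : E → Forms 𝕜 E) x)) =
      ℓ ((creation 𝕜 T v u : E → Forms 𝕜 E) x) := by
  rw [fderiv_functional_comp, creation_apply, map_add, map_smul, map_smul, map_neg]
  rfl

theorem functional_oscillator {ι : Type*} [Fintype ι] {e : OrthonormalBasis ι ℝ E} {T ν : ℝ}
    {u : Sections 𝕜 E} (h : oscillator 𝕜 e T u = (ν : 𝕜) • u) (ℓ : Forms 𝕜 E →L[ℝ] ℝ) (x : E) :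
    ∑ i, (-fderiv ℝ (fun y => ℓ ((annihilation 𝕜 T (e i) u : E → Forms 𝕜 E) y)) x (e i) +
      T * (inner ℝ (e i) x * ℓ ((annihilation 𝕜 T (e i) u : E → Forms 𝕜 E) x))) =
      ν * ℓ ((u : E → Forms 𝕜 E) x) := by
  simp_rw [functional_creation]
  have h' := congrArg (fun w : Sections 𝕜 E => ℓ ((w : E → Forms 𝕜 E) x)) h
  simp only [section_smul_apply, oscillator, LinearMap.sum_apply, section_sum_apply, map_sum] at h'
  rw [← RCLike.real_smul_eq_coe_smul, map_smul] at h'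
  exact h'

/-- With the integrating factor `exp (T |x|² / 2)`, the equations say that the product has zero
derivative, hence is constant. -/
theorem apply_eq_zero_of_annihilation {ι : Type*} [Fintype ι] {e : OrthonormalBasis ι ℝ E} {T : ℝ}
    {u : Sections 𝕜 E} (h : ∀ i, annihilation 𝕜 T (e i) u = 0) (x : E) :
    (u : E → Forms 𝕜 E) x = Real.exp (-(T * ‖x‖ ^ 2) / 2) • (u : E → Forms 𝕜 E) 0 := by
  have hD : ∀ y, fderiv ℝ (u : E → Forms 𝕜 E) y +
      (T • innerSL ℝ y).smulRight ((u : E → Forms 𝕜 E) y) = 0 := by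
    intro y
    refine ContinuousLinearMap.coe_injective (e.toBasis.ext fun i => ?_)
    have h' := congrArg (fun w : Sections 𝕜 E => (w : E → Forms 𝕜 E) y) (h i)
    simp only [annihilation_apply] at h'
    simpa [smul_smul, real_inner_comm] using h'
  have hexp : ∀ y : E, HasFDerivAt (fun y : E => Real.exp (T * ‖y‖ ^ 2 / 2))
      (Real.exp (T * ‖y‖ ^ 2 / 2) • (T • innerSL ℝ y)) y := by
    intro y
    have h1 := (((hasStrictFDerivAt_norm_sq y).hasFDerivAt.const_mul T).mul_const (2⁻¹ : ℝ)).exp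
    simp only [← div_eq_mul_inv] at h1
    refine h1.congr_fderiv (ContinuousLinearMap.ext fun v => ?_)
    simp only [_root_.smul_apply, smul_eq_mul, nsmul_eq_mul, Nat.cast_ofNat]
    ring
  have hw : ∀ y, HasFDerivAt (fun y => Real.exp (T * ‖y‖ ^ 2 / 2) • (u : E → Forms 𝕜 E) y)
      (0 : E →L[ℝ] Forms 𝕜 E) y := by
    intro y
    have h1 := (hexp y).smul (differentiableAt_section u y).hasFDerivAt
    refine HasFDerivAt.congr_fderiv h1 ?_
    have h2 := congrArg (fun L => Real.exp (T * ‖y‖ ^ 2 / 2) • L) (hD y)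
    simp only [smul_add, smul_zero] at h2
    refine Eq.trans (ContinuousLinearMap.ext fun v => ?_) h2
    simp [smul_smul, mul_assoc]
  have hc := is_const_of_fderiv_eq_zero (𝕜 := ℝ) (fun y => (hw y).differentiableAt)
    (fun y => (hw y).fderiv) x 0
  simp only [norm_zero, ne_eq, OfNat.ofNat_ne_zero, not_false_eq_true, zero_pow, mul_zero,
    zero_div, Real.exp_zero, one_smul] at hc
  rw [← hc, smul_smul, ← Real.exp_add]
  rw [show -(T * ‖x‖ ^ 2) / 2 + T * ‖x‖ ^ 2 / 2 = 0 by ring, Real.exp_zero, one_smul]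

theorem eq_zero_of_functionals {w : Forms 𝕜 E} (h : ∀ ℓ : Forms 𝕜 E →L[ℝ] ℝ, ℓ w = 0) :
    w = 0 := by
  refine (finBasis ℝ (Forms 𝕜 E)).ext_elem fun i => ?_
  rw [map_zero]
  exact h ((finBasis ℝ (Forms 𝕜 E)).coord i).toContinuousLinearMap

theorem annihilation_gaussian (T : ℝ) (v : E) : annihilation 𝕜 T v (gaussian 𝕜 E T) = 0 := by
  refine section_ext fun x => ?_
  rw [annihilation_apply, section_zero_apply]
  have h1 : HasFDerivAt (fun y : E => Real.exp (-(T * ‖y‖ ^ 2) / 2)) _ x :=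
    (((hasStrictFDerivAt_norm_sq x).hasFDerivAt.const_mul T).neg.mul_const (2⁻¹ : ℝ)).exp
  have h2 : HasFDerivAt (gaussian 𝕜 E T : E → Forms 𝕜 E) _ x :=
    h1.smul_const (1 : Forms 𝕜 E)
  rw [h2.fderiv]
  change _ + T • (inner ℝ v x : ℝ) • Real.exp (-(T * ‖x‖ ^ 2) / 2) • (1 : Forms 𝕜 E) = 0
  simp only [ContinuousLinearMap.smulRight_apply, smul_smul, ← add_smul]
  convert zero_smul ℝ (1 : Forms 𝕜 E)
  simp [real_inner_comm]
  ring_nf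

/-- The wedge terms vanish because every `A_i` kills the Gaussian; the others because contraction,
moved past `B_i`, kills forms of degree 0. -/
theorem gaussian_mem_ker (e : OrthonormalBasis (Fin (finrank ℝ E)) ℝ E) (T : ℝ) :
    gaussian 𝕜 E T ∈ LinearMap.ker (deformedDirac 𝕜 e T) := by
  rw [LinearMap.mem_ker, deformedDirac_eq, LinearMap.sum_apply]
  refine Finset.sum_eq_zero fun i _ => ?_
  rw [LinearMap.add_apply, Module.End.mul_apply, annihilation_gaussian, map_zero, zero_add,
    ← creation_mul_applyEnd, Module.End.mul_apply]
  have h : applyEnd 𝕜 (interior 𝕜 (e i)) (gaussian 𝕜 E T) = 0 := by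
    refine section_ext fun x => ?_
    change ((interior 𝕜 (e i)).restrictScalars ℝ)
      (Real.exp (-(T * ‖x‖ ^ 2) / 2) • (1 : Forms 𝕜 E)) = 0
    rw [map_smul]
    have h1 : interior 𝕜 (e i) (1 : Forms 𝕜 E) = 0 :=
      CliffordAlgebra.contractLeft_one (Q := (0 : QuadraticForm 𝕜 (E →ₗ[ℝ] 𝕜))) (evalAt 𝕜 (e i))
    rw [LinearMap.restrictScalars_apply, h1, smul_zero]
  rw [h, map_zero]

theorem gaussian_ne_zero (T : ℝ) : gaussian 𝕜 E T ≠ 0 := by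
  intro h
  have h' := congrArg (fun w : Sections 𝕜 E => (w : E → Forms 𝕜 E) 0) h
  have h1 : Real.exp (-(T * ‖(0 : E)‖ ^ 2) / 2) • (1 : Forms 𝕜 E) = 0 := h'
  simp at h1

variable [MeasurableSpace E] [BorelSpace E]

theorem gaussian_mem_L2Sections {T : ℝ} (hT : 0 < T) : gaussian 𝕜 E T ∈ L2Sections 𝕜 E := by
  have hc : Continuous fun x : E => Real.exp (-(T * ‖x‖ ^ 2) / 2) := by fun_prop
  have h : MemLp (fun x : E => Real.exp (-(T * ‖x‖ ^ 2) / 2)) 2 volume := by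
    rw [memLp_two_iff_integrable_sq hc.aestronglyMeasurable]
    -- The square of the section's coefficient is `exp (-T |x|²)`, the modulus of the complex
    -- Gaussian with parameter `T`.
    have h1 := (GaussianFourier.integrable_cexp_neg_mul_sq_norm_add (V := E) (b := (T : ℂ))
      (by simpa using hT) 0 0).norm
    refine h1.congr (ae_of_all _ fun x => ?_)
    simp only [Complex.norm_exp, ← Real.exp_nat_mul]
    congr 1
    simp [← Complex.ofReal_pow, ← Complex.ofReal_mul]
    ring
  exact (ContinuousLinearMap.toSpanSingleton ℝ (1 : Forms 𝕜 E)).comp_memLp' h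

theorem mem_L2Sections_of_functionals {u : Sections 𝕜 E} (h : ∀ ℓ : Forms 𝕜 E →L[ℝ] ℝ,
    MemLp (fun x => ℓ ((u : E → Forms 𝕜 E) x)) 2 volume) : u ∈ L2Sections 𝕜 E := by
  let L := (finBasis ℝ (Forms 𝕜 E)).equivFunL
  have h1 : MemLp (fun x => L ((u : E → Forms 𝕜 E) x)) 2 (volume : Measure E) :=
    memLp_pi_iff.2 fun i => h ((finBasis ℝ (Forms 𝕜 E)).coord i).toContinuousLinearMap
  have h2 := (L.symm : _ →L[ℝ] Forms 𝕜 E).comp_memLp' h1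
  have h3 : ((L.symm : _ →L[ℝ] Forms 𝕜 E) ∘ fun x => L ((u : E → Forms 𝕜 E) x)) =
      (u : E → Forms 𝕜 E) := funext fun x => L.symm_apply_apply _
  rwa [h3] at h2

theorem integrable_functional_sq {u : Sections 𝕜 E} (hu : u ∈ L2Sections 𝕜 E)
    (ℓ : Forms 𝕜 E →L[ℝ] ℝ) : Integrable fun x => ℓ ((u : E → Forms 𝕜 E) x) ^ 2 := by
  have hu' : MemLp (u : E → Forms 𝕜 E) 2 volume := hu
  exact (ℓ.comp_memLp' hu').integrable_sq

theorem applyEnd_mem_L2Sections (A : Forms 𝕜 E →ₗ[𝕜] Forms 𝕜 E) {u : Sections 𝕜 E}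
    (hu : u ∈ L2Sections 𝕜 E) : applyEnd 𝕜 A u ∈ L2Sections 𝕜 E := by
  have hu' : MemLp (u : E → Forms 𝕜 E) 2 volume := hu
  exact (A.restrictScalars ℝ).toContinuousLinearMap.comp_memLp' hu'

variable {ι : Type*} [Fintype ι] {e : OrthonormalBasis ι ℝ E} {T ν : ℝ} {u : Sections 𝕜 E}

theorem annihilation_mem_L2Sections (hu : u ∈ L2Sections 𝕜 E)
    (h : oscillator 𝕜 e T u = (ν : 𝕜) • u) (i : ι) :
    annihilation 𝕜 T (e i) u ∈ L2Sections 𝕜 E := by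
  refine mem_L2Sections_of_functionals fun ℓ => ?_
  rw [memLp_two_iff_integrable_sq
    (contDiff_functional_comp ℓ _).continuous.aestronglyMeasurable]
  exact integrable_sq_of_energy (contDiff_functional_comp ℓ u)
    (g := fun i x => ℓ ((annihilation 𝕜 T (e i) u : E → Forms 𝕜 E) x))
    (fun i => contDiff_functional_comp ℓ _)
    (integrable_functional_sq hu ℓ) (fun i x => functional_annihilation ℓ T (e i) u x)
    (fun x => functional_oscillator h ℓ x) i

/-- The harmonic oscillator has no negative eigenvalue. -/
theorem eq_zero_of_oscillator_neg (hu : u ∈ L2Sections 𝕜 E)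
    (h : oscillator 𝕜 e T u = (ν : 𝕜) • u) (hν : ν < 0) : u = 0 := by
  refine section_ext fun x => eq_zero_of_functionals fun ℓ => ?_
  exact congrFun (eq_zero_of_energy_neg (contDiff_functional_comp ℓ u)
    (g := fun i x => ℓ ((annihilation 𝕜 T (e i) u : E → Forms 𝕜 E) x))
    (fun i => contDiff_functional_comp ℓ _)
    (integrable_functional_sq hu ℓ) (fun i x => functional_annihilation ℓ T (e i) u x)
    (fun x => functional_oscillator h ℓ x) hν) x

/-- The spectral gap of the harmonic oscillator. -/
theorem annihilation_eq_zero_of_lt (hu : u ∈ L2Sections 𝕜 E)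
    (h : oscillator 𝕜 e T u = (ν : 𝕜) • u) (hν : ν < 2 * T) (i : ι) :
    annihilation 𝕜 T (e i) u = 0 := by
  -- `A_i u` is square-integrable and would have the negative eigenvalue `ν - 2T`.
  refine eq_zero_of_oscillator_neg (e := e) (T := T) (ν := ν - 2 * T)
    (annihilation_mem_L2Sections hu h i) ?_ (by linarith)
  rw [oscillator_annihilation, h, map_smul, RCLike.ofReal_sub]
  exact (sub_smul _ _ _).symm

theorem eq_zero_of_oscillator_lt (hu : u ∈ L2Sections 𝕜 E)
    (h : oscillator 𝕜 e T u = (ν : 𝕜) • u) (hν : ν < 2 * T) (hν0 : ν ≠ 0) : u = 0 := by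
  have h0 : oscillator 𝕜 e T u = 0 := by
    rw [oscillator, LinearMap.sum_apply]
    refine Finset.sum_eq_zero fun i _ => ?_
    rw [Module.End.mul_apply, annihilation_eq_zero_of_lt hu h hν, map_zero]
  rw [h] at h0
  exact (smul_eq_zero.1 h0).resolve_left (by exact_mod_cast hν0)

end Spectrum

/-! ### Assembling the degrees: spectral gap and kernel. -/

section Kernel

variable {𝕜 E : Type*} [RCLike 𝕜] [NormedAddCommGroup E] [InnerProductSpace ℝ E]
  [FiniteDimensional ℝ E]

theorem eq_zero_of_applyEnd_degreeProj {u : Sections 𝕜 E}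
    (h : ∀ k, applyEnd 𝕜 (degreeProj 𝕜 E k) u = 0) : u = 0 :=
  section_ext fun x => eq_zero_of_degreeProj fun k =>
    congrArg (fun w : Sections 𝕜 E => (w : E → Forms 𝕜 E) x) (h k)

theorem applyEnd_degreeProj_zero_eq {u : Sections 𝕜 E}
    (h : ∀ k, k ≠ 0 → applyEnd 𝕜 (degreeProj 𝕜 E k) u = 0) :
    applyEnd 𝕜 (degreeProj 𝕜 E 0) u = u := by
  rw [← sub_eq_zero]
  refine eq_zero_of_applyEnd_degreeProj fun k => ?_
  rw [map_sub]
  have h1 : applyEnd 𝕜 (degreeProj 𝕜 E k) (applyEnd 𝕜 (degreeProj 𝕜 E 0) u) =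
      if k = 0 then applyEnd 𝕜 (degreeProj 𝕜 E 0) u else 0 := by
    refine section_ext fun x => (degreeProj_of_mem k (degreeProj_mem 0 _)).trans ?_
    split_ifs <;> rfl
  rw [h1]
  split_ifs with hk
  · rw [hk, sub_self]
  · rw [h k hk, sub_zero]

variable [MeasurableSpace E] [BorelSpace E]

/-- For `k ≥ 1` the oscillator eigenvalue `μ² - 2Tk` is at most `μ² - 2T < 0`. -/
theorem degreeProj_eq_zero_of_eigen {e : OrthonormalBasis (Fin (finrank ℝ E)) ℝ E} {T μ : ℝ}
    (hT : 0 < T) {u : Sections 𝕜 E} (hu : u ∈ L2Sections 𝕜 E)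
    (h : deformedDirac 𝕜 e T u = (μ : 𝕜) • u) (hμ : μ ^ 2 < 2 * T) {k : ℕ} (hk : k ≠ 0) :
    applyEnd 𝕜 (degreeProj 𝕜 E k) u = 0 := by
  refine eq_zero_of_oscillator_neg (applyEnd_mem_L2Sections _ hu) (oscillator_degreeProj e h k) ?_
  have : (1 : ℝ) ≤ k := by exact_mod_cast Nat.one_le_iff_ne_zero.2 hk
  nlinarith

theorem eq_zero_of_eigen {e : OrthonormalBasis (Fin (finrank ℝ E)) ℝ E} {T μ : ℝ}
    (hT : 0 < T) {u : Sections 𝕜 E} (hu : u ∈ L2Sections 𝕜 E)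
    (h : deformedDirac 𝕜 e T u = (μ : 𝕜) • u) (hμ : μ ^ 2 < 2 * T) (hμ0 : μ ≠ 0) : u = 0 := by
  refine eq_zero_of_applyEnd_degreeProj fun k => ?_
  by_cases hk : k = 0
  · subst hk
    exact eq_zero_of_oscillator_lt (applyEnd_mem_L2Sections _ hu) (oscillator_degreeProj e h 0)
      (by simpa using hμ) (by simpa using hμ0)
  · exact degreeProj_eq_zero_of_eigen hT hu h hμ hk

theorem ker_inf_L2Sections (e : OrthonormalBasis (Fin (finrank ℝ E)) ℝ E) {T : ℝ} (hT : 0 < T) :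
    LinearMap.ker (deformedDirac 𝕜 e T) ⊓ L2Sections 𝕜 E =
      Submodule.span 𝕜 {gaussian 𝕜 E T} := by
  refine le_antisymm ?_ ?_
  · rintro u ⟨hker, hu⟩
    have h : deformedDirac 𝕜 e T u = ((0 : ℝ) : 𝕜) • u := by
      rw [LinearMap.mem_ker.1 hker]
      simp
    have h0 : applyEnd 𝕜 (degreeProj 𝕜 E 0) u = u := applyEnd_degreeProj_zero_eq fun k hk =>
      degreeProj_eq_zero_of_eigen hT hu h (by simpa using hT) hk
    have hosc := oscillator_degreeProj e h 0
    rw [h0] at hosc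
    have hA := annihilation_eq_zero_of_lt hu hosc (by simpa using hT)
    have hmem : (u : E → Forms 𝕜 E) 0 ∈ ⋀[𝕜]^0 (E →ₗ[ℝ] 𝕜) := by
      rw [← h0]
      exact degreeProj_mem 0 _
    -- The value at the origin has degree 0, so it is a scalar; it is the coefficient of the
    -- Gaussian.
    obtain ⟨a, ha⟩ := exists_algebraMap_of_mem_zero hmem
    refine Submodule.mem_span_singleton.2 ⟨a, section_ext fun x => ?_⟩
    rw [apply_eq_zero_of_annihilation hA x, ← ha, Algebra.algebraMap_eq_smul_one]
    exact smul_comm a (Real.exp (-(T * ‖x‖ ^ 2) / 2)) (1 : Forms 𝕜 E)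
  · rw [Submodule.span_singleton_le_iff_mem]
    exact ⟨gaussian_mem_ker e T, gaussian_mem_L2Sections hT⟩

end Kernel

end

end WittenDirac

open WittenDirac in
theorem theoremA3 (𝕜 : Type*) [RCLike 𝕜] (E : Type*) [NormedAddCommGroup E]
    [InnerProductSpace ℝ E] [FiniteDimensional ℝ E] [MeasurableSpace E] [BorelSpace E]
    (hE : Even (Module.finrank ℝ E))
    (e : OrthonormalBasis (Fin (Module.finrank ℝ E)) ℝ E) :
    (∀ T : ℝ, 0 < T →
      Module.finrank 𝕜 ↥(LinearMap.ker (deformedDirac 𝕜 e T) ⊓ L2Sections 𝕜 E) = 1 ∧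
      LinearMap.ker (deformedDirac 𝕜 e T) ⊓ L2Sections 𝕜 E =
        Submodule.span 𝕜 {gaussian 𝕜 E T}) ∧
    ∃ C : ℝ, 0 < C ∧ ∀ T : ℝ, 0 < T → ∀ μ : ℝ, μ ≠ 0 →
      μ ∈ Set.Icc (-(C * √T)) (C * √T) →
      ∀ u ∈ L2Sections 𝕜 E, deformedDirac 𝕜 e T u = (μ : 𝕜) • u → u = 0 := by
  -- Any `C` with `0 < C` and `C² < 2` would do, since only `μ² < 2T` is needed; here `C = 1`.
  refine ⟨fun T hT => ⟨?_, ker_inf_L2Sections e hT⟩, 1, one_pos, fun T hT μ hμ0 hμ u hu h => ?_⟩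
  · rw [ker_inf_L2Sections e hT]
    exact finrank_span_singleton (gaussian_ne_zero T)
  · refine eq_zero_of_eigen hT hu h ?_ hμ0
    rw [one_mul] at hμ
    have h1 : μ ^ 2 ≤ √T ^ 2 := sq_le_sq' hμ.1 hμ.2
    rw [Real.sq_sqrt hT.le] at h1
    linarith
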